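/- Let $H$ be an abelian group. Say that a group is \emph{arithmetically linear} if it is isomorphic to a subgroup of $\mathrm{GL}_n(C)$ for some integer $n \ge 0$ and some finitely generated commutative $\mathbb{Z}$-algebra $C$. Say that an abelian group $B$ is \emph{bounded} if $nB = 0$ for some positive integer $n$, and that an abelian group is \emph{cobounded} if, for some positive integer $n$, it is isomorphic to a subgroup of a direct sum of (possibly infinitely many) copies of the additive group of $\mathbb{Z}[1/n]$. Then $H$ is arithmetically linear if and only if $H$ is countable (finite or countably infinite) and $H \cong B \times C$ for some bounded abelian group $B$ and some cobounded abelian group $C$. -/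

import Mathlib

universe u v

/-- A group is arithmetically linear if it embeds as a subgroup of `GL_n(C)` for some `n` and some
finitely generated commutative `ℤ`-algebra `C`. -/
def IsArithmeticallyLinear (G : Type u) [Group G] : Prop :=
  ∃ (n : ℕ) (C : Type v) (_ : CommRing C), Algebra.FiniteType ℤ C ∧
    ∃ f : G →* Matrix.GeneralLinearGroup (Fin n) C, Function.Injective f

/-- An abelian group `B` is bounded if `n B = 0` for some positive integer `n`. -/
def IsBoundedAddGroup (B : Type u) [AddCommGroup B] : Prop :=
  ∃ n : ℕ, 0 < n ∧ ∀ b : B, n • b = 0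

/-- An abelian group is cobounded if, for some positive integer `n`, it embeds in a direct sum of
(possibly infinitely many) copies of `ℤ[1/n]`. -/
def IsCoboundedAddGroup (A : Type u) [AddCommGroup A] : Prop :=
  ∃ n : ℕ, 0 < n ∧ ∃ (ι : Type u) (f : A →+ (ι →₀ Localization.Away (n : ℤ))),
    Function.Injective f

/-- An abelian group is bounded × cobounded if it is isomorphic to `B × C` with `B` bounded and
`C` cobounded. -/
def IsBoundedTimesCobounded (H : Type u) [AddCommGroup H] : Prop :=
  ∃ (B C : Type u) (_ : AddCommGroup B) (_ : AddCommGroup C),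
    IsBoundedAddGroup B ∧ IsCoboundedAddGroup C ∧ Nonempty (H ≃+ B × C)

/-! If H = B × C is countable, B embeds in the additive group of (ℤ/n)[X] and C in that of
ℤ[1/m][X]. The product of these two rings is finitely generated, and its additive group sits in GL₂
as unipotent matrices.

Conversely, the C-subalgebra of Mₙ(C) generated by a commutative matrix group H is a finitely
generated commutative ring A, and H embeds in Aˣ. The argument rests on the class
`IsBoundedByCobounded`, which is closed under subgroups and, because submodules of free
ℤ[1/m]-modules are projective, under extensions (`of_ker`). It contains the additive group of A:
dévissage reduces to domains, where Noether normalisation over ℚ involves only finitely many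
denominators.

For Aˣ (`units`), the nilradical contributes only additive groups, the reduced quotient embeds in a
finite product of domains, and the units of a domain lie in a finitely generated field. Such a field
is reached from a number field or a finite field by simple extensions. At a transcendental step,
divisors leave only the units of the field of constants; at the bottom, Dirichlet's unit theorem
settles number fields. Finally, a bounded kernel with torsion-free quotient splits off
(`AddSubgroup.exists_isCompl_of_bounded`). -/

section Subrings

/-! ### The rings ℤ[1/m] and submodules of their free modules. -/

open scoped TensorProduct

/-- The subring `ℤ[1/m]` of `ℚ`. -/
abbrev invSubring (m : ℕ) : Subring ℚ := Subring.closure {(m : ℚ)⁻¹}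

theorem inv_mem_invSubring (m : ℕ) : (m : ℚ)⁻¹ ∈ invSubring m :=
  Subring.subset_closure rfl

theorem invSubring_le_of_dvd {m n : ℕ} (hn : n ≠ 0) (h : m ∣ n) : invSubring m ≤ invSubring n := by
  obtain ⟨k, rfl⟩ := h
  rw [invSubring, Subring.closure_le, Set.singleton_subset_iff]
  have hk : (k : ℚ) ≠ 0 := by
    rintro h0
    exact hn (by simp [Nat.cast_eq_zero.mp h0])
  have : (m : ℚ)⁻¹ = k * ((m * k : ℕ) : ℚ)⁻¹ := by
    push_cast
    rw [mul_inv, mul_comm, mul_assoc, inv_mul_cancel₀ hk, mul_one]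
  rw [this]
  exact mul_mem (natCast_mem _ _) (inv_mem_invSubring _)

theorem mem_invSubring_den (q : ℚ) : q ∈ invSubring q.den := by
  have h : (q.num : ℚ) * (q.den : ℚ)⁻¹ ∈ invSubring q.den :=
    mul_mem (intCast_mem _ _) (inv_mem_invSubring _)
  rwa [← div_eq_mul_inv, Rat.num_div_den] at h

theorem exists_pow_mul_eq_of_mem_invSubring {m : ℕ} (hm : m ≠ 0) {q : ℚ} (hq : q ∈ invSubring m) :
    ∃ (k : ℕ) (z : ℤ), (m : ℚ) ^ k * q = z := by
  have hm' : (m : ℚ) ≠ 0 := by exact_mod_cast hm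
  induction hq using Subring.closure_induction with
  | mem x hx => exact ⟨1, 1, by rw [hx]; simp [hm']⟩
  | zero => exact ⟨0, 0, by simp⟩
  | one => exact ⟨0, 1, by simp⟩
  | add x y _ _ hx hy =>
    obtain ⟨k, z, h⟩ := hx
    obtain ⟨l, w, h'⟩ := hy
    refine ⟨k + l, m ^ l * z + m ^ k * w, ?_⟩
    push_cast
    rw [← h, ← h']
    ring
  | neg x _ hx =>
    obtain ⟨k, z, h⟩ := hx
    exact ⟨k, -z, by push_cast; rw [← h]; ring⟩
  | mul x y _ _ hx hy =>
    obtain ⟨k, z, h⟩ := hx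
    obtain ⟨l, w, h'⟩ := hy
    refine ⟨k + l, z * w, ?_⟩
    push_cast
    rw [← h, ← h']
    ring

theorem isLocalization_invSubring {m : ℕ} (hm : m ≠ 0) :
    IsLocalization.Away (m : ℤ) (invSubring m) := by
  have hm' : (m : ℚ) ≠ 0 := by exact_mod_cast hm
  refine (isLocalization_iff _ _).mpr ⟨?_, ?_, ?_⟩
  · rintro ⟨_, k, rfl⟩
    simp only [map_pow]
    refine IsUnit.pow _ (IsUnit.of_mul_eq_one ⟨_, inv_mem_invSubring m⟩ ?_)
    ext
    simp [hm']
  · rintro ⟨q, hq⟩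
    obtain ⟨k, z, h⟩ := exists_pow_mul_eq_of_mem_invSubring hm hq
    refine ⟨⟨z, ⟨_, k, rfl⟩⟩, ?_⟩
    ext
    simp [← h, mul_comm]
  · intro x y h
    refine ⟨1, ?_⟩
    have : x = y := by
      have := congrArg (fun x : invSubring m => (x : ℚ)) h
      simpa using this
    rw [this]

theorem isPrincipalIdealRing_invSubring {m : ℕ} (hm : m ≠ 0) :
    IsPrincipalIdealRing (invSubring m) := by
  have := isLocalization_invSubring hm
  refine ⟨fun I => ?_⟩
  have hI := IsLocalization.map_under (Submonoid.powers (m : ℤ)) (invSubring m) I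
  obtain ⟨a, ha⟩ := IsPrincipalIdealRing.principal (I.under ℤ)
  rw [← hI, ha]
  exact ⟨_, by rw [Ideal.submodule_span_eq, Ideal.map_span, Set.image_singleton]⟩

section Projective

variable {R : Type*} [CommRing R] [IsDomain R] [IsPrincipalIdealRing R]

/-- Over a principal ideal domain, submodules of `ℕ →₀ R` are projective. -/
theorem projective_submodule_finsupp_nat (P : Submodule R (ℕ →₀ R)) : Module.Projective R P := by
  classical
  -- leading coefficients at position `n`
  let F : ℕ → Submodule R (ℕ →₀ R) := fun n => P ⊓ Finsupp.supported R R (Set.Iic n)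
  let I : ℕ → Ideal R := fun n => (F n).map (Finsupp.lapply n)
  have hgen : ∀ n, ∃ p ∈ F n, I n = Ideal.span {p n} := by
    intro n
    obtain ⟨a, ha⟩ := IsPrincipalIdealRing.principal (I n)
    have : a ∈ I n := by rw [ha]; exact Submodule.mem_span_singleton_self a
    obtain ⟨p, hp, rfl⟩ := this
    exact ⟨p, hp, ha⟩
  choose p hp hI using hgen
  -- `p n` realises a generator of the ideal of leading coefficients in position `n`. Those with
  -- nonzero leading coefficient form an echelon basis of `P`.
  let J : Set ℕ := {n | p n n ≠ 0}
  have hpP : ∀ n, p n ∈ P := fun n => (hp n).1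
  have hps : ∀ n k, n < k → p n k = 0 := by
    intro n k hk
    by_contra h
    have := (Finsupp.mem_supported R _).mp (hp n).2 (Finsupp.mem_support_iff.mpr h)
    exact absurd this (by simpa using hk)
  let v : J → P := fun j => ⟨p j, hpP j⟩
  have hli : LinearIndependent R v := by
    refine LinearIndependent.of_comp P.subtype ?_
    have hv : P.subtype ∘ v = fun j : J => p j := rfl
    rw [hv, linearIndependent_iff']
    intro s c hs
    by_contra! hne
    obtain ⟨j₀, hj₀, hc₀⟩ := hne
    obtain ⟨j, hj, hmax⟩ := (s.filter fun j => c j ≠ 0).exists_max_image (fun j => (j : ℕ))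
      ⟨j₀, by simp [hj₀, hc₀]⟩
    rw [Finset.mem_filter] at hj
    have h1 := DFunLike.congr_fun hs (j : ℕ)
    simp only [Finsupp.finsetSum_apply, Finsupp.smul_apply, smul_eq_mul, Finsupp.coe_zero,
      Pi.zero_apply] at h1
    rw [Finset.sum_eq_single j] at h1
    · exact (mul_ne_zero hj.2 j.2) h1
    · intro i hi hij
      by_cases hci : c i = 0
      · simp [hci]
      · have hle := hmax i (by simp [hi, hci])
        rw [hps i j (lt_of_le_of_ne hle fun h => hij (Subtype.ext h)), mul_zero]
    · exact fun h => absurd hj.1 h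
  have hspan : ∀ n, ∀ x (hx : x ∈ P), (∀ k, n ≤ k → x k = 0) →
      (⟨x, hx⟩ : P) ∈ Submodule.span R (Set.range v) := by
    intro n
    induction n with
    | zero =>
      intro x hx h
      have : (⟨x, hx⟩ : P) = 0 := by ext k; exact h k (Nat.zero_le _)
      rw [this]
      exact zero_mem _
    | succ n ih =>
      intro x hx h
      have hxF : x ∈ F n := by
        refine ⟨hx, (Finsupp.mem_supported R _).mpr fun k hk => ?_⟩
        by_contra hnk
        exact (Finsupp.mem_support_iff.mp hk) (h k (by simpa using hnk))
      have hxI : x n ∈ I n := ⟨x, hxF, rfl⟩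
      rw [hI, Ideal.mem_span_singleton'] at hxI
      obtain ⟨c, hc⟩ := hxI
      have h2 := ih (x - c • p n) (sub_mem hx (P.smul_mem c (hpP n))) (by
        intro k hk
        rcases hk.eq_or_lt with rfl | hk
        · simp [hc]
        · simp [h k hk, hps n k hk])
      by_cases hn : p n n = 0
      · refine ih x hx fun k hk => ?_
        rcases hk.eq_or_lt with rfl | hk
        · rw [← hc, hn, mul_zero]
        · exact h k hk
      · have : (⟨x, hx⟩ : P) = ⟨x - c • p n, sub_mem hx (P.smul_mem c (hpP n))⟩ +
            c • v ⟨n, hn⟩ := by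
          ext1
          simp [v]
        rw [this]
        exact add_mem h2 (Submodule.smul_mem _ _ (Submodule.subset_span ⟨_, rfl⟩))
  have htop : ⊤ ≤ Submodule.span R (Set.range v) := by
    rintro ⟨x, hx⟩ -
    refine hspan (x.support.sup id + 1) x hx fun k hk => ?_
    by_contra h
    have := Finset.le_sup (f := id) (Finsupp.mem_support_iff.mpr h)
    simp only [id] at this
    omega
  exact Module.Projective.of_basis (Module.Basis.mk hli htop)

end Projective

end Subrings

/-! ### Closure of bounded-by-cobounded groups under extensions. -/

section Extension

open scoped TensorProduct

section Extend

/-- A homomorphism from the kernel of `G` to `ℕ →₀ ℤ[1/m]` extends to the source of `G`, when `G`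
takes values in `ℕ →₀ ℤ[1/m]`. -/
theorem exists_extend_of_ker {m : ℕ} (hm : m ≠ 0) {A : Type*} [AddCommGroup A]
    (G : A →+ (ℕ →₀ invSubring m)) (φ : G.ker →+ (ℕ →₀ invSubring m)) :
    ∃ h : A →+ (ℕ →₀ invSubring m), ∀ x : G.ker, h x = φ x := by
  have := isLocalization_invSubring hm
  have := isPrincipalIdealRing_invSubring hm
  let R := invSubring m
  let S := Submonoid.powers (m : ℤ)
  let F := ℕ →₀ R
  let j : A →ₗ[ℤ] R ⊗[ℤ] A := TensorProduct.mk ℤ R A 1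
  have hj : IsLocalizedModule S j := IsLocalization.tensorProduct_isLocalizedModule S R
  have hF : IsLocalizedModule S (LinearMap.id : F →ₗ[ℤ] F) := isLocalizedModule_id S F R
  let g : A →ₗ[ℤ] F := G.toIntLinearMap
  let gT : R ⊗[ℤ] A →ₗ[ℤ] F := IsLocalizedModule.map S j LinearMap.id g
  let gR : R ⊗[ℤ] A →ₗ[R] F := gT.extendScalarsOfIsLocalization S R
  have hgR : ∀ t, gR t = gT t := fun t => rfl
  have hgj : ∀ a, gT (j a) = G a := fun a => IsLocalizedModule.map_apply S j LinearMap.id g a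
  -- After tensoring with ℤ[1/m] the image becomes a projective module, so the localised map splits
  -- and `ρ` projects onto its kernel. Over ℤ the map `G` itself need not split.
  have : Module.Projective R (LinearMap.range gR) := projective_submodule_finsupp_nat _
  obtain ⟨s, hs⟩ := Module.projective_lifting_property gR.rangeRestrict LinearMap.id
    gR.surjective_rangeRestrict
  have hs' : ∀ y, gR (s y) = y := fun y => congrArg Subtype.val (LinearMap.congr_fun hs y)
  let ρ : R ⊗[ℤ] A →ₗ[ℤ] LinearMap.ker gT :=
    LinearMap.codRestrict _ ((LinearMap.id - s ∘ₗ gR.rangeRestrict).restrictScalars ℤ) (by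
      intro t
      rw [LinearMap.mem_ker, ← hgR]
      simp [hs'])
  let k := LinearMap.toKerIsLocalized S j (LinearMap.id : F →ₗ[ℤ] F) g
  have hk : IsLocalizedModule S k := LinearMap.toKerLocalized_isLocalizedModule R S j LinearMap.id g
  let φ' : LinearMap.ker g →ₗ[ℤ] F := φ.toIntLinearMap
  -- The kernel of `gT` is the localisation of the kernel of `g`, and `m` is already invertible on
  -- `F`, so `φ` factors through it.
  let ψ : LinearMap.ker gT →ₗ[ℤ] F := IsLocalizedModule.lift S k φ' hF.map_units
  refine ⟨(ψ ∘ₗ ρ ∘ₗ j).toAddMonoidHom, fun x => ?_⟩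
  have hx : ρ (j x) = k x := by
    ext1
    have h0 : gR.rangeRestrict (j x) = 0 := by
      ext1
      change gT (j x) = 0
      rw [hgj]
      exact x.2
    change j x - s (gR.rangeRestrict (j x)) = j x
    rw [h0, map_zero, sub_zero]
  change ψ (ρ (j x)) = φ x
  rw [hx]
  exact IsLocalizedModule.lift_apply S k φ' _ x

end Extend

section Reindex

theorem exists_finsupp_nat_of_countable_index {A ι M : Type*} [AddCommGroup A] [AddCommGroup M]
    [Countable ι] (f : A →+ (ι →₀ M)) : ∃ f' : A →+ (ℕ →₀ M), ∀ x, f' x = 0 ↔ f x = 0 := by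
  obtain ⟨e, he⟩ := Countable.exists_injective_nat ι
  refine ⟨(Finsupp.mapDomain.addMonoidHom e).comp f, fun x => ⟨fun hx => ?_, fun hx => ?_⟩⟩
  · exact Finsupp.mapDomain_injective he (hx.trans Finsupp.mapDomain_zero.symm)
  · simp [hx]

/-- A homomorphism from a countable group to a direct sum factors through countably many
summands. -/
theorem exists_finsupp_nat {A ι M : Type*} [AddCommGroup A] [AddCommGroup M]
    [Countable A] (f : A →+ (ι →₀ M)) : ∃ f' : A →+ (ℕ →₀ M), ∀ x, f' x = 0 ↔ f x = 0 := by
  let s : Set ι := ⋃ x, (f x).support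
  have hs : s.Countable := Set.countable_iUnion fun x => (f x).support.countable_toSet
  have := hs.to_subtype
  obtain ⟨f', hf'⟩ := exists_finsupp_nat_of_countable_index
    ((Finsupp.comapDomain.addMonoidHom (Subtype.val_injective (p := (· ∈ s)))).comp f)
  refine ⟨f', fun x => (hf' x).trans ⟨fun hx => ?_, fun hx => by simp [hx]⟩⟩
  ext i : 1
  by_cases hi : i ∈ s
  · exact DFunLike.congr_fun hx ⟨i, hi⟩
  · by_contra h
    exact hi (Set.mem_iUnion.mpr ⟨x, Finsupp.mem_support_iff.mpr h⟩)

end Reindex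

/-- An abelian group is bounded-by-cobounded if it has a homomorphism to a direct sum of countably
many copies of some `ℤ[1/m]` whose kernel is bounded. -/
def IsBoundedByCobounded (A : Type*) [AddCommGroup A] : Prop :=
  ∃ n m : ℕ, n ≠ 0 ∧ m ≠ 0 ∧ ∃ f : A →+ (ℕ →₀ invSubring m), ∀ x, f x = 0 → n • x = 0

namespace IsBoundedByCobounded

theorem of_nsmul_eq_zero {A : Type*} [AddCommGroup A] {n : ℕ} (hn : n ≠ 0)
    (h : ∀ x : A, n • x = 0) : IsBoundedByCobounded A :=
  ⟨n, 1, hn, one_ne_zero, 0, fun x _ => h x⟩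

theorem of_finite {A : Type*} [AddCommGroup A] [Finite A] : IsBoundedByCobounded A :=
  of_nsmul_eq_zero Nat.card_pos.ne' fun _ => card_nsmul_eq_zero' (G := A)

theorem comap {A A' : Type*} [AddCommGroup A] [AddCommGroup A'] (h : IsBoundedByCobounded A')
    (g : A →+ A') {k : ℕ} (hk : k ≠ 0) (hg : ∀ x, g x = 0 → k • x = 0) :
    IsBoundedByCobounded A := by
  obtain ⟨n, m, hn, hm, f, hf⟩ := h
  refine ⟨k * n, m, mul_ne_zero hk hn, hm, f.comp g, fun x hx => ?_⟩
  have := hf _ hx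
  rw [← map_nsmul] at this
  rw [mul_smul]
  exact hg _ this

theorem of_injective {A A' : Type*} [AddCommGroup A] [AddCommGroup A']
    (h : IsBoundedByCobounded A') (g : A →+ A') (hg : Function.Injective g) :
    IsBoundedByCobounded A :=
  h.comap g one_ne_zero fun x hx => by
    rw [one_smul]; exact hg (hx.trans (map_zero g).symm)

theorem of_finsupp {A ι : Type*} [AddCommGroup A] [Countable A] {n m : ℕ} (hn : n ≠ 0)
    (hm : m ≠ 0) (f : A →+ (ι →₀ invSubring m)) (hf : ∀ x, f x = 0 → n • x = 0) :
    IsBoundedByCobounded A := by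
  obtain ⟨f', hf'⟩ := exists_finsupp_nat f
  exact ⟨n, m, hn, hm, f', fun x hx => hf x ((hf' x).mp hx)⟩

theorem of_finsupp_int {A ι : Type*} [AddCommGroup A] [Countable A] {n : ℕ} (hn : n ≠ 0)
    (f : A →+ (ι →₀ ℤ)) (hf : ∀ x, f x = 0 → n • x = 0) : IsBoundedByCobounded A := by
  let c : ℤ →+ invSubring 1 := (Int.castRingHom (invSubring 1)).toAddMonoidHom
  have hc : Function.Injective c := by
    intro a b h
    have : (a : ℚ) = b := congrArg Subtype.val h
    exact_mod_cast this
  refine of_finsupp hn one_ne_zero ((Finsupp.mapRange.addMonoidHom c).comp f) fun x hx => hf x ?_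
  exact Finsupp.mapRange_injective c (map_zero c) hc (hx.trans Finsupp.mapRange_zero.symm)

theorem exists_finsupp_of_dvd {A : Type*} [AddCommGroup A] {m M : ℕ} (hM : M ≠ 0) (h : m ∣ M)
    (f : A →+ (ℕ →₀ invSubring m)) :
    ∃ f' : A →+ (ℕ →₀ invSubring M), (∀ x, f' x = 0 ↔ f x = 0) := by
  let c : invSubring m →+ invSubring M :=
    (Subring.inclusion (invSubring_le_of_dvd hM h)).toAddMonoidHom
  have hc : Function.Injective c := Subring.inclusion_injective (invSubring_le_of_dvd hM h)
  refine ⟨(Finsupp.mapRange.addMonoidHom c).comp f, fun x => ⟨fun hx => ?_, fun hx => ?_⟩⟩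
  · exact Finsupp.mapRange_injective c (map_zero c) hc (hx.trans Finsupp.mapRange_zero.symm)
  · simp [hx]

/-- Bounded-by-cobounded abelian groups are closed under extensions. -/
theorem of_ker {A A' : Type*} [AddCommGroup A] [AddCommGroup A'] (g : A →+ A')
    (h : IsBoundedByCobounded A') (hker : IsBoundedByCobounded g.ker) :
    IsBoundedByCobounded A := by
  obtain ⟨n, m, hn, hm, f, hf⟩ := h
  obtain ⟨n₁, m₁, hn₁, hm₁, f₁, hf₁⟩ := hker
  have hM : m * m₁ ≠ 0 := mul_ne_zero hm hm₁
  obtain ⟨F, hF⟩ := exists_finsupp_of_dvd hM (dvd_mul_right m m₁) f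
  obtain ⟨F₁, hF₁⟩ := exists_finsupp_of_dvd hM (dvd_mul_left m₁ m) f₁
  let G := F.comp g
  have hG : ∀ x : G.ker, n • (x : A) ∈ g.ker := fun x => by
    rw [AddMonoidHom.mem_ker, map_nsmul]
    exact hf _ ((hF _).mp x.2)
  -- `G.ker` may exceed `g.ker`, but `n` carries it into `g.ker`. Hence it is `F₁ (n • x)` that gets
  -- extended to `A`, and the final exponent is `n₁ * n`.
  let q : G.ker →+ g.ker := AddMonoidHom.codRestrict
    ((nsmulAddMonoidHom n).comp G.ker.subtype) g.ker hG
  obtain ⟨H, hH⟩ := exists_extend_of_ker hM G (F₁.comp q)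
  let e : (ℕ →₀ invSubring (m * m₁)) × (ℕ →₀ invSubring (m * m₁)) ≃+
    (ℕ ⊕ ℕ →₀ invSubring (m * m₁)) := Finsupp.sumFinsuppAddEquivProdFinsupp.symm
  obtain ⟨f', hf'⟩ := exists_finsupp_nat_of_countable_index (e.toAddMonoidHom.comp (G.prod H))
  refine ⟨n₁ * n, m * m₁, mul_ne_zero hn₁ hn, hM, f', fun x hx => ?_⟩
  have hx' : (G x, H x) = 0 := (map_eq_zero_iff e e.injective).mp ((hf' x).mp hx)
  rw [Prod.mk_eq_zero] at hx'
  have h1 := hH ⟨x, hx'.1⟩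
  have h2 := hf₁ _ ((hF₁ _).mp (h1.symm.trans hx'.2))
  rw [mul_smul]
  exact congrArg Subtype.val h2

theorem of_finite_family {ι : Type*} {B : ι → Type*} [∀ i, AddCommGroup (B i)]
    (s : Finset ι) (hB : ∀ i ∈ s, IsBoundedByCobounded (B i)) {A : Type*} [AddCommGroup A]
    (g : ∀ i, A →+ B i) (hg : ∀ x, (∀ i ∈ s, g i x = 0) → x = 0) : IsBoundedByCobounded A := by
  classical
  -- Stated for subgroups so that the induction can pass to the kernel of one component.
  suffices H : ∀ K : AddSubgroup A, (∀ x ∈ K, (∀ i ∈ s, g i x = 0) → x = 0) →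
      IsBoundedByCobounded K by
    exact (H ⊤ fun x _ => hg x).of_injective ((AddMonoidHom.id A).codRestrict ⊤ fun _ => trivial)
      fun x y h => congrArg Subtype.val h
  clear hg
  induction s using Finset.induction_on with
  | empty =>
    intro K hK
    refine of_nsmul_eq_zero one_ne_zero fun x => ?_
    rw [one_smul]
    exact Subtype.ext (hK x x.2 (by simp))
  | insert i s _ ih =>
    intro K hK
    refine of_ker ((g i).comp K.subtype) (hB i (by simp)) ?_
    have := ih (fun j hj => hB j (by simp [hj])) (K ⊓ (g i).ker) (fun x hx h =>
      hK x hx.1 fun j hj => by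
        rcases Finset.mem_insert.mp hj with rfl | hj
        · exact hx.2
        · exact h j hj)
    refine this.of_injective (AddMonoidHom.codRestrict
      (K.subtype.comp ((g i).comp K.subtype).ker.subtype) _ fun x => ⟨x.1.2, x.2⟩) fun x y h => ?_
    exact Subtype.ext (Subtype.ext (congrArg (fun z : (K ⊓ (g i).ker : AddSubgroup A) => (z : A)) h))

end IsBoundedByCobounded

end Extension

/-! ### Splitting off the bounded part. -/

section Splitting

/-- `D` is the preimage of a linear complement to the image of `B` in the 𝔽ₚ-vector space H/pH. Then
B ∩ D = B ∩ pH, which is pB by the divisibility hypothesis. -/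
theorem AddSubgroup.exists_sup_eq_top_inf_eq_map_of_prime {H : Type*} [AddCommGroup H]
    (B : AddSubgroup H) {p : ℕ} (hp : p.Prime) (h : ∀ x, p • x ∈ B → x ∈ B) :
    ∃ D : AddSubgroup H, B ⊔ D = ⊤ ∧ B ⊓ D = B.map (nsmulAddMonoidHom p) := by
  have := Fact.mk hp
  let P : AddSubgroup H := (nsmulAddMonoidHom (α := H) p).range
  have hP : ∀ x : H ⧸ P, p • x = 0 := by
    intro x
    induction x using QuotientAddGroup.induction_on with
    | H x => exact (QuotientAddGroup.eq_zero_iff (p • x)).mpr ⟨x, rfl⟩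
  let := AddCommGroup.zmodModule hP
  let q := QuotientAddGroup.mk' P
  obtain ⟨W, hW⟩ : ∃ W : AddSubgroup (H ⧸ P), IsCompl (B.map q) W := by
    let e : AddSubgroup (H ⧸ P) ≃o Submodule (ZMod p) (H ⧸ P) := AddSubgroup.toZModSubmodule p
    obtain ⟨W, hW⟩ := exists_isCompl (e (B.map q))
    exact ⟨e.symm W, (OrderIso.isCompl_iff e).mpr (by rwa [e.apply_symm_apply])⟩
  refine ⟨W.comap q, ?_, ?_⟩
  · rw [eq_top_iff]
    intro x _
    have hx : q x ∈ B.map q ⊔ W := by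
      rw [hW.sup_eq_top]; trivial
    obtain ⟨y, ⟨b, hb, rfl⟩, w, hw, hyw⟩ := AddSubgroup.mem_sup.mp hx
    refine AddSubgroup.mem_sup.mpr ⟨b, hb, x - b, ?_, by abel⟩
    have : q (x - b) = w := by rw [map_sub, ← hyw, add_sub_cancel_left]
    change q (x - b) ∈ W
    rwa [this]
  · ext x
    constructor
    · rintro ⟨hx, hxW⟩
      have : q x ∈ B.map q ⊓ W := ⟨⟨x, hx, rfl⟩, hxW⟩
      rw [hW.inf_eq_bot] at this
      obtain ⟨y, rfl⟩ := (QuotientAddGroup.eq_zero_iff x).mp this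
      exact ⟨y, h y hx, rfl⟩
    · rintro ⟨y, hy, rfl⟩
      refine ⟨nsmul_mem hy p, ?_⟩
      have : q (nsmulAddMonoidHom p y) = 0 := (QuotientAddGroup.eq_zero_iff _).mpr ⟨y, rfl⟩
      change q (nsmulAddMonoidHom p y) ∈ W
      rw [this]
      exact zero_mem _

/-- A bounded subgroup with torsion-free quotient is a direct summand. -/
theorem AddSubgroup.exists_isCompl_of_bounded {H : Type u} [AddCommGroup H] (B : AddSubgroup H)
    {n : ℕ} (hn : n ≠ 0) (hB : ∀ x ∈ B, n • x = 0) (h : ∀ k : ℕ, k ≠ 0 → ∀ x, k • x ∈ B → x ∈ B) :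
    ∃ D : AddSubgroup H, IsCompl B D := by
  induction n using induction_on_primes generalizing H with
  | zero => exact absurd rfl hn
  | one =>
    have : B = ⊥ := (AddSubgroup.eq_bot_iff_forall B).mpr fun x hx => by simpa using hB x hx
    exact ⟨⊤, this ▸ isCompl_bot_top⟩
  | prime_mul p n hp ih =>
    obtain ⟨D, hBD, hBD'⟩ := B.exists_sup_eq_top_inf_eq_map_of_prime hp (h p hp.ne_zero)
    -- B ∩ D = pB is killed by `n` and inherits the divisibility condition inside `D`. A complement
    -- of it in `D` is a complement of `B` in `H`.
    obtain ⟨E, hE⟩ := ih (B.addSubgroupOf D) (right_ne_zero_of_mul hn) (by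
      intro x hx
      have : (x : H) ∈ B ⊓ D := ⟨hx, x.2⟩
      rw [hBD'] at this
      obtain ⟨y, hy, hyx⟩ := this
      ext1
      rw [AddSubgroup.coe_nsmul, ← hyx, AddSubgroup.coe_zero, ← hB y hy, mul_comm, mul_smul]
      rfl) (fun k hk x hx => h k hk x hx)
    refine ⟨E.map D.subtype, ?_, ?_⟩
    · rw [AddSubgroup.disjoint_def]
      rintro x hx ⟨y, hy, rfl⟩
      have := AddSubgroup.disjoint_def.mp hE.disjoint (show y ∈ B.addSubgroupOf D from hx) hy
      rw [this, map_zero]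
    · rw [codisjoint_iff, eq_top_iff, ← hBD]
      refine sup_le le_sup_left fun x hx => ?_
      have : (⟨x, hx⟩ : D) ∈ B.addSubgroupOf D ⊔ E := by
        rw [hE.sup_eq_top]; trivial
      obtain ⟨b, hb, e, he, hbe⟩ := AddSubgroup.mem_sup.mp this
      exact AddSubgroup.mem_sup.mpr ⟨b, hb, e, ⟨e, he, rfl⟩, congrArg Subtype.val hbe⟩

theorem nonempty_addEquiv_prod_of_isCompl {H : Type*} [AddCommGroup H] {B D : AddSubgroup H}
    (h : IsCompl B D) : Nonempty (H ≃+ B × D) := by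
  let e : B × D →+ H := B.subtype.coprod D.subtype
  refine ⟨(AddEquiv.ofBijective e ⟨?_, ?_⟩).symm⟩
  · rw [injective_iff_map_eq_zero]
    rintro ⟨b, d⟩ hbd
    have hbd' : (b : H) = -d := eq_neg_of_add_eq_zero_left hbd
    have hb : (b : H) = 0 := AddSubgroup.disjoint_def.mp h.disjoint b.2 (hbd' ▸ neg_mem d.2)
    have hd : (d : H) = 0 := by rw [hb] at hbd'; exact neg_eq_zero.mp hbd'.symm
    exact Prod.ext (Subtype.ext hb) (Subtype.ext hd)
  · intro x
    have hx : x ∈ B ⊔ D := by rw [h.sup_eq_top]; trivial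
    obtain ⟨b, hb, d, hd, hbd⟩ := AddSubgroup.mem_sup.mp hx
    exact ⟨(⟨b, hb⟩, ⟨d, hd⟩), hbd⟩

theorem IsBoundedByCobounded.isBoundedTimesCobounded {H : Type u} [AddCommGroup H]
    (h : IsBoundedByCobounded H) : IsBoundedTimesCobounded H := by
  obtain ⟨n, m, hn, hm, f, hf⟩ := h
  obtain ⟨D, hD⟩ := f.ker.exists_isCompl_of_bounded hn hf (by
    intro k hk x hx
    rw [AddMonoidHom.mem_ker, map_nsmul] at hx
    rw [AddMonoidHom.mem_ker]
    ext i
    have := congrArg Subtype.val (DFunLike.congr_fun hx i)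
    simpa [hk] using this)
  refine ⟨f.ker, D, inferInstance, inferInstance, ⟨n, Nat.pos_of_ne_zero hn, fun b => ?_⟩,
    ⟨m, Nat.pos_of_ne_zero hm, ULift ℕ, ?_⟩, nonempty_addEquiv_prod_of_isCompl hD⟩
  · exact Subtype.ext (hf b b.2)
  · have := isLocalization_invSubring hm
    let c : invSubring m ≃+ Localization.Away (m : ℤ) :=
      (IsLocalization.algEquiv (Submonoid.powers (m : ℤ)) (invSubring m)
        (Localization.Away (m : ℤ))).toRingEquiv.toAddEquiv
    let e : (ℕ →₀ invSubring m) ≃+ (ULift ℕ →₀ Localization.Away (m : ℤ)) :=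
      (Finsupp.mapRange.addEquiv c).trans (Finsupp.domCongr Equiv.ulift.symm)
    refine ⟨e.toAddMonoidHom.comp (f.comp D.subtype), ?_⟩
    refine e.injective.comp ((injective_iff_map_eq_zero (f.comp D.subtype)).mpr fun x hx => ?_)
    exact Subtype.ext (AddSubgroup.disjoint_def.mp hD.disjoint hx x.2)

end Splitting

/-! ### Countable bounded groups inside direct sums of ℤ/n. -/

section BoundedEmbedding

/-- Characters to ℚ/ℤ separate points, and on a group killed by `n` they take values in (1/n)ℤ/ℤ, a
copy of ℤ/n. -/
theorem exists_addMonoidHom_zmod_ne_zero {A : Type*} [AddCommGroup A] {n : ℕ} (hn : n ≠ 0)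
    (h : ∀ x : A, n • x = 0) {a : A} (ha : a ≠ 0) : ∃ φ : A →+ ZMod n, φ a ≠ 0 := by
  have hn' : (n : ℚ) ≠ 0 := by exact_mod_cast hn
  obtain ⟨c, hc⟩ := CharacterModule.exists_character_apply_ne_zero_of_ne_zero ha
  let c' : A →+ AddCircle (1 : ℚ) := c
  let g : ℤ →+ AddCircle (1 : ℚ) :=
    (QuotientAddGroup.mk' _).comp ((AddMonoidHom.mulRight ((n : ℚ)⁻¹)).comp (Int.castAddHom ℚ))
  have hg : ∀ z : ℤ, g z = ((z * (n : ℚ)⁻¹ : ℚ) : AddCircle (1 : ℚ)) := fun z => rfl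
  let e : ZMod n →+ AddCircle (1 : ℚ) := ZMod.lift n ⟨g, by
    rw [hg]
    simp [hn']⟩
  have he : Function.Injective e := by
    rw [ZMod.lift_injective]
    intro z hz
    change g z = 0 at hz
    rw [hg, AddCircle.coe_eq_zero_iff] at hz
    obtain ⟨k, hk⟩ := hz
    rw [ZMod.intCast_zmod_eq_zero_iff_dvd]
    refine ⟨k, ?_⟩
    field_simp at hk
    have : (z : ℚ) = n * k := by rw [← hk]; simp [mul_comm]
    exact_mod_cast this
  have hr : ∀ x, c' x ∈ e.range := by
    intro x
    have h1 : n • c' x = 0 := by rw [← map_nsmul, h, map_zero]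
    obtain ⟨q, hq⟩ := QuotientAddGroup.mk_surjective (c' x)
    rw [← hq] at h1 ⊢
    have h2 : ((n • q : ℚ) : AddCircle (1 : ℚ)) = 0 := h1
    rw [AddCircle.coe_eq_zero_iff] at h2
    obtain ⟨k, hk⟩ := h2
    refine ⟨(k : ZMod n), ?_⟩
    change ZMod.lift n _ (k : ZMod n) = _
    rw [ZMod.lift_coe]
    change g k = _
    rw [hg]
    congr 1
    have : (k : ℚ) = n * q := by simpa using hk
    rw [this]
    field_simp
  let E := AddMonoidHom.ofInjective he
  refine ⟨E.symm.toAddMonoidHom.comp (c'.codRestrict e.range hr), fun h0 => hc ?_⟩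
  have := (map_eq_zero_iff E.symm E.symm.injective).mp h0
  exact congrArg Subtype.val this

/-- A countable bounded abelian group embeds in a direct sum of copies of `ℤ/n`. -/
theorem exists_injective_finsupp_zmod {A : Type*} [AddCommGroup A] [Countable A] {n : ℕ}
    (hn : n ≠ 0) (h : ∀ x : A, n • x = 0) :
    ∃ f : A →+ (ℕ →₀ ZMod n), Function.Injective f := by
  classical
  obtain ⟨b, hb⟩ := exists_surjective_nat A
  let B : ℕ → AddSubgroup A := fun k => AddSubgroup.closure (b '' Set.Iio k)
  have hBfin : ∀ k, Finite (B k) := by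
    intro k
    have : AddGroup.FG (B k) := by
      rw [AddGroup.fg_iff_addSubgroup_fg]
      exact ⟨(Set.toFinite (b '' Set.Iio k)).toFinset, by simp [B]⟩
    exact AddCommGroup.finite_of_fg_isAddTorsion _ fun x =>
      isOfFinAddOrder_iff_nsmul_eq_zero.mpr ⟨n, Nat.pos_of_ne_zero hn, Subtype.ext (h x)⟩
  have hBmono : Monotone B := fun k l hkl =>
    AddSubgroup.closure_mono (Set.image_mono (Set.Iio_subset_Iio hkl))
  have hBex : ∀ x, ∃ k, x ∈ B k := fun x => by
    obtain ⟨k, rfl⟩ := hb x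
    exact ⟨k + 1, AddSubgroup.subset_closure ⟨k, Nat.lt_succ_self k, rfl⟩⟩
  have hB0 : B 0 = ⊥ := by simp [B]
  -- `φ x` kills every finite subgroup `B k` that misses `x`, so y ∈ B k is seen only by the
  -- finitely many x ∈ B k. This puts the joint map in the direct sum rather than the product.
  have hφ : ∀ x : A, ∃ φ : A →+ ZMod n, (∀ k, x ∉ B k → ∀ y ∈ B k, φ y = 0) ∧
      (x ≠ 0 → φ x ≠ 0) := by
    intro x
    by_cases hx : x = 0
    · exact ⟨0, by simp, fun h => absurd hx h⟩
    have hpos : Nat.find (hBex x) ≠ 0 := by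
      intro h0
      have := Nat.find_spec (hBex x)
      rw [h0, hB0] at this
      exact hx this
    obtain ⟨k, hk⟩ := Nat.exists_eq_succ_of_ne_zero hpos
    have hxk : x ∉ B k := Nat.find_min (hBex x) (by omega)
    obtain ⟨ψ, hψ⟩ := exists_addMonoidHom_zmod_ne_zero (A := A ⧸ B k) hn (fun y => by
      induction y using QuotientAddGroup.induction_on with
      | H y => exact (QuotientAddGroup.eq_zero_iff (n • y)).mpr (by rw [h y]; exact zero_mem _))
      (a := (x : A ⧸ B k)) (fun h0 => hxk ((QuotientAddGroup.eq_zero_iff x).mp h0))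
    refine ⟨ψ.comp (QuotientAddGroup.mk' (B k)), fun l hl y hy => ?_, fun _ => hψ⟩
    have hlk : l ≤ k := by
      by_contra hlt
      exact hl (hBmono (by omega : Nat.find (hBex x) ≤ l) (Nat.find_spec (hBex x)))
    have : (QuotientAddGroup.mk' (B k)) y = 0 := (QuotientAddGroup.eq_zero_iff y).mpr (hBmono hlk hy)
    rw [AddMonoidHom.comp_apply, this, map_zero]
  choose φ hφ hφ' using hφ
  let Φ : A →+ (A →₀ ZMod n) :=
    { toFun := fun y => Finsupp.ofSupportFinite (fun x => φ x y) (by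
        obtain ⟨k, hk⟩ := hBex y
        refine (Set.toFinite (B k : Set A)).subset fun x hx => ?_
        by_contra hxk
        exact hx (hφ x k hxk y hk))
      map_zero' := by ext; simp [Finsupp.ofSupportFinite_coe]
      map_add' := fun y z => by ext; simp [Finsupp.ofSupportFinite_coe] }
  obtain ⟨f, hf⟩ := exists_finsupp_nat Φ
  refine ⟨f, (injective_iff_map_eq_zero f).mpr fun x hx => ?_⟩
  by_contra hx0
  exact hφ' x hx0 (DFunLike.congr_fun ((hf x).mp hx) x)

end BoundedEmbedding

/-! ### From bounded × cobounded to unipotent matrices. -/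

section Linear

theorem IsArithmeticallyLinear.of_addMonoidHom {H : Type u} [AddCommGroup H] {R : Type}
    [CommRing R] {φ : ℤ →+* R} (hR : φ.FiniteType) (f : H →+ R) (hf : Function.Injective f) :
    IsArithmeticallyLinear.{u, v} (Multiplicative H) := by
  have : Algebra.FiniteType ℤ R :=
    RingHom.finiteType_algebraMap.mp (by rwa [RingHom.ext_int (algebraMap ℤ R) φ])
  let e : R ≃ₐ[ℤ] ULift.{v} R := ULift.algEquiv.symm
  refine ⟨2, ULift.{v} R, inferInstance, Algebra.FiniteType.equiv ‹_› e, ?_⟩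
  let g : H →+ ULift.{v} R := e.toRingEquiv.toAddEquiv.toAddMonoidHom.comp f
  refine ⟨Matrix.GeneralLinearGroup.upperRightHom.toMonoidHom.comp (AddMonoidHom.toMultiplicative g),
    ?_⟩
  exact Matrix.GeneralLinearGroup.injective_upperRightHom.comp (e.injective.comp hf)

open Polynomial in
theorem exists_injective_finsupp_nat_to_polynomial (R : Type*) [CommRing R] :
    ∃ f : (ℕ →₀ R) →+ R[X], Function.Injective f := by
  let f : (ℕ →₀ R) →+ R[X] := Finsupp.liftAddHom fun i => (monomial i).toAddMonoidHom
  have hf : ∀ x i, (f x).coeff i = x i := by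
    intro x i
    change (x.sum fun i a => monomial i a).coeff i = x i
    rw [Finsupp.sum, finsetSum_coeff]
    simp [coeff_monomial, eq_comm]
  refine ⟨f, fun x y h => ?_⟩
  ext i
  rw [← hf, ← hf, h]

open Polynomial in
theorem IsBoundedTimesCobounded.isArithmeticallyLinear {H : Type u} [AddCommGroup H] [Countable H]
    (h : IsBoundedTimesCobounded H) : IsArithmeticallyLinear.{u, v} (Multiplicative H) := by
  obtain ⟨B, C, _, _, ⟨n, hn, hB⟩, ⟨m, hm, ι, f, hf⟩, ⟨e⟩⟩ := h
  have : Countable (B × C) := e.surjective.countable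
  have : Countable B := Prod.fst_surjective (β := C) |>.countable
  have : Countable C := Prod.snd_surjective (α := B) |>.countable
  obtain ⟨g, hg⟩ := exists_injective_finsupp_zmod hn.ne' hB
  obtain ⟨f', hf'⟩ := exists_finsupp_nat f
  have hf'' : Function.Injective f' := (injective_iff_map_eq_zero f').mpr fun x hx =>
    (injective_iff_map_eq_zero f).mp hf x ((hf' x).mp hx)
  obtain ⟨p, hp⟩ := exists_injective_finsupp_nat_to_polynomial (ZMod n)
  obtain ⟨q, hq⟩ := exists_injective_finsupp_nat_to_polynomial (Localization.Away (m : ℤ))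
  have : Algebra.FiniteType ℤ (ZMod n) :=
    Algebra.FiniteType.of_surjective (Int.castRingHom (ZMod n)).toIntAlgHom ZMod.intCast_surjective
  have : Algebra.FiniteType ℤ (Localization.Away (m : ℤ)) := inferInstance
  have hR := (RingHom.finiteType_algebraMap (A := ℤ)
    (B := (ZMod n)[X] × (Localization.Away (m : ℤ))[X])).mpr Algebra.FiniteType.prod
  refine IsArithmeticallyLinear.of_addMonoidHom hR
    (((p.comp g).prodMap (q.comp f')).comp e.toAddMonoidHom) ?_
  exact (Function.Injective.prodMap (hp.comp hg) (hq.comp hf'')).comp e.injective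

end Linear

/-! ### Additive groups of finitely generated rings and modules. -/

section AdditiveGroups

open MvPolynomial

/-- `E` embeds in a finite-dimensional space over the fraction field; a common denominator for the
coordinates of finitely many generators moves the image into Pᴺ. -/
theorem Module.exists_injective_pi_of_isTorsionFree (P : Type*) [CommRing P] [IsDomain P]
    (E : Type*) [AddCommGroup E] [Module P E] [Module.Finite P E] [Module.IsTorsionFree P E] :
    ∃ (N : ℕ) (f : E →ₗ[P] (Fin N → P)), Function.Injective f := by
  let S := nonZeroDivisors P
  let K := Localization S
  let V := LocalizedModule S E
  let : Field K := inferInstanceAs (Field (FractionRing P))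
  let j : E →ₗ[P] V := LocalizedModule.mkLinearMap S E
  have hj : Function.Injective j := by
    rw [injective_iff_map_eq_zero]
    intro x hx
    obtain ⟨c, hc⟩ := (IsLocalizedModule.eq_zero_iff S j).mp hx
    exact (smul_eq_zero.mp (show (c : P) • x = 0 from hc)).resolve_left
      (nonZeroDivisors.ne_zero c.2)
  have : Module.Finite K V := Module.Finite.of_isLocalizedModule S j
  let b := Module.finBasis K V
  obtain ⟨k, w, hw⟩ := Module.Finite.exists_fin (R := P) (M := E)
  let N := Module.finrank K V
  let c : E →ₗ[P] (Fin N → K) := (b.equivFun.toLinearMap.restrictScalars P) ∘ₗ j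
  have hc : Function.Injective c := b.equivFun.injective.comp hj
  obtain ⟨d, hd⟩ := IsLocalization.exist_integer_multiples_of_finite S
    (fun p : Fin k × Fin N => c (w p.1) p.2)
  let a : (Fin N → P) →ₗ[P] (Fin N → K) := LinearMap.compLeft (Algebra.linearMap P K) (Fin N)
  have ha : Function.Injective a := by
    intro x y hxy
    ext i
    exact IsFractionRing.injective P K (congrFun hxy i)
  have hmem : ∀ x, (d : P) • c x ∈ LinearMap.range a := by
    intro x
    have hx : x ∈ Submodule.span P (Set.range w) := hw ▸ trivial
    induction hx using Submodule.span_induction with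
    | mem x hx =>
      obtain ⟨l, rfl⟩ := hx
      choose y hy using fun t => hd (l, t)
      exact ⟨y, funext hy⟩
    | zero => simp
    | add x y _ _ hx hy => rw [map_add, smul_add]; exact add_mem hx hy
    | smul r x _ hx => rw [map_smul, smul_comm]; exact Submodule.smul_mem _ _ hx
  let e := LinearEquiv.ofInjective a ha
  refine ⟨N, e.symm.toLinearMap ∘ₗ LinearMap.codRestrict (LinearMap.range a) ((d : P) • c) hmem,
    e.symm.injective.comp fun x y hxy => hc ?_⟩
  have h1 : (d : P) • c x = (d : P) • c y := congrArg Subtype.val hxy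
  have h2 : (d : P) ≠ 0 := nonZeroDivisors.ne_zero d.2
  ext t
  have h3 := congrFun h1 t
  simp only [Pi.smul_apply, Algebra.smul_def] at h3
  exact mul_left_cancel₀ (fun h => h2 (IsFractionRing.injective P K (h.trans (map_zero _).symm))) h3

section Denominators

/-- The polynomials over `ℚ` with coefficients in `ℤ[1/m]`. -/
noncomputable abbrev invPolynomials (σ : Type*) (m : ℕ) : Subring (MvPolynomial σ ℚ) :=
  (MvPolynomial.map (σ := σ) (invSubring m).subtype).range

theorem mem_invPolynomials {σ : Type*} {m : ℕ} {p : MvPolynomial σ ℚ} :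
    p ∈ invPolynomials σ m ↔ ∀ d, p.coeff d ∈ invSubring m := by
  change p ∈ Set.range (MvPolynomial.map (invSubring m).subtype) ↔ _
  rw [mem_range_map_iff_coeffs_subset]
  constructor
  · intro h d
    by_cases hd : p.coeff d = 0
    · rw [hd]; exact zero_mem _
    · obtain ⟨x, hx⟩ := h (coeff_mem_coeffs d hd)
      exact hx ▸ x.2
  · intro h x hx
    obtain ⟨d, _, rfl⟩ := mem_coeffs_iff.mp hx
    exact ⟨⟨_, h d⟩, rfl⟩

theorem exists_mem_invPolynomials {σ ι : Type*} [Finite ι] (p : ι → MvPolynomial σ ℚ) :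
    ∃ m : ℕ, m ≠ 0 ∧ ∀ i, p i ∈ invPolynomials σ m := by
  cases nonempty_fintype ι
  let M := ∏ i, ∏ d ∈ (p i).support, ((p i).coeff d).den
  have hM : M ≠ 0 := Finset.prod_ne_zero_iff.mpr fun i _ =>
    Finset.prod_ne_zero_iff.mpr fun d _ => Rat.den_ne_zero _
  refine ⟨M, hM, fun i => mem_invPolynomials.mpr fun d => ?_⟩
  by_cases hd : d ∈ (p i).support
  · refine invSubring_le_of_dvd hM ?_ (mem_invSubring_den _)
    exact (Finset.dvd_prod_of_mem (fun d => ((p i).coeff d).den) hd).trans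
      (Finset.dvd_prod_of_mem (fun i => ∏ d ∈ (p i).support, ((p i).coeff d).den)
        (Finset.mem_univ i))
  · rw [notMem_support_iff.mp hd]
    exact zero_mem _

theorem IsBoundedByCobounded.of_invPolynomials {σ : Type*} [Countable σ] {m : ℕ} (hm : m ≠ 0) :
    IsBoundedByCobounded (invPolynomials σ m) := by
  let f : MvPolynomial σ (invSubring m) →+ ((σ →₀ ℕ) →₀ invSubring m) :=
    AddMonoidAlgebra.coeffAddEquiv.toAddMonoidHom
  obtain ⟨f', hf'⟩ := exists_finsupp_nat_of_countable_index f
  have h : IsBoundedByCobounded (MvPolynomial σ (invSubring m)) := by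
    refine ⟨1, m, one_ne_zero, hm, f', fun x hx => ?_⟩
    rw [one_smul]
    exact (map_eq_zero_iff _ AddMonoidAlgebra.coeffAddEquiv.injective).mp ((hf' x).mp hx)
  let e := (RingEquiv.ofBijective (MvPolynomial.map (σ := σ) (invSubring m).subtype).rangeRestrict
    ⟨fun x y hxy => MvPolynomial.map_injective _ Subtype.val_injective (congrArg Subtype.val hxy),
      RingHom.rangeRestrict_surjective _⟩).symm
  exact h.of_injective e.toAddEquiv.toAddMonoidHom e.injective

end Denominators

theorem Algebra.FiniteType.int_of_surjective {R S : Type*} [CommRing R] [CommRing S]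
    [Algebra.FiniteType ℤ R] (f : R →+* S) (hf : Function.Surjective f) : Algebra.FiniteType ℤ S :=
  Algebra.FiniteType.of_surjective f.toIntAlgHom hf

/-- The ℚ-algebra `E` generated by `D` is finite and torsion-free over a polynomial ring `P`
(Noether normalisation), so it embeds in Pᴺ. Since `D` is finitely generated over ℤ, inverting one
integer `m` suffices to describe its image. -/
theorem IsBoundedByCobounded.of_finiteType_domain_charZero (D : Type*) [CommRing D] [IsDomain D]
    [CharZero D] [hD : Algebra.FiniteType ℤ D] : IsBoundedByCobounded D := by
  obtain ⟨s, hs⟩ := hD.out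
  let K := FractionRing D
  have : CharZero K := IsFractionRing.charZero D
  let i : D →+* K := algebraMap D K
  have hi : Function.Injective i := IsFractionRing.injective D K
  let E := Algebra.adjoin ℚ (i '' (s : Set D))
  have : Algebra.FiniteType ℚ E := Algebra.FiniteType.adjoin_of_finite (s.finite_toSet.image i)
  have hiE : ∀ d, i d ∈ E := by
    intro d
    have hd : d ∈ Algebra.adjoin ℤ (s : Set D) := hs ▸ trivial
    induction hd using Algebra.adjoin_induction with
    | mem x hx => exact Algebra.subset_adjoin ⟨x, hx, rfl⟩
    | algebraMap z => simp
    | add x y _ _ hx hy => rw [map_add]; exact add_mem hx hy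
    | mul x y _ _ hx hy => rw [map_mul]; exact mul_mem hx hy
  let j : D →+* E := i.codRestrict E hiE
  have hj : Function.Injective j := fun x y h => hi (congrArg Subtype.val h)
  obtain ⟨r, g, hg, hgfin⟩ := exists_finite_inj_algHom_of_fg ℚ E
  let P := MvPolynomial (Fin r) ℚ
  let : Algebra P E := g.toRingHom.toAlgebra
  have hfin : Module.Finite P E := hgfin
  have : FaithfulSMul P E := (faithfulSMul_iff_algebraMap_injective P E).mpr hg
  have : Module.IsTorsionFree P E := inferInstance
  obtain ⟨N, Φ, hΦ⟩ := Module.exists_injective_pi_of_isTorsionFree P E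
  obtain ⟨k, w, hw⟩ := Module.Finite.exists_fin (R := P) (M := E)
  have hrep : ∀ x : E, ∃ c : Fin k → P, ∑ l, c l • w l = x := fun x =>
    (Submodule.mem_span_range_iff_exists_fun P).mp (hw ▸ trivial)
  choose c hc using hrep
  -- The three denominators belong to multiplication by the generators of `D` on the `w l`, to the
  -- expansion of 1, and to the coordinates of `Φ (w l)`.
  obtain ⟨m₁, hm₁, h₁⟩ := exists_mem_invPolynomials (fun p : s × Fin k × Fin k =>
    c (j p.1 * w p.2.1) p.2.2)
  obtain ⟨m₂, hm₂, h₂⟩ := exists_mem_invPolynomials (c 1)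
  obtain ⟨m₃, hm₃, h₃⟩ := exists_mem_invPolynomials (fun p : Fin k × Fin N => Φ (w p.1) p.2)
  let m := m₁ * m₂ * m₃
  have hm : m ≠ 0 := mul_ne_zero (mul_ne_zero hm₁ hm₂) hm₃
  have hle : ∀ {q}, q ∣ m → invPolynomials (Fin r) q ≤ invPolynomials (Fin r) m := fun h p hp =>
    mem_invPolynomials.mpr fun d => invSubring_le_of_dvd hm h (mem_invPolynomials.mp hp d)
  let Pm := invPolynomials (Fin r) m
  let L : Submodule Pm E := Submodule.span Pm (Set.range w)
  have hL : ∀ a : Fin k → P, (∀ l, a l ∈ Pm) → ∑ l, a l • w l ∈ L := fun a ha =>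
    sum_mem fun l _ => Submodule.smul_mem L (⟨a l, ha l⟩ : Pm) (Submodule.subset_span ⟨l, rfl⟩)
  have hone : (1 : E) ∈ L := by
    rw [← hc 1]
    exact hL _ fun l => hle ((dvd_mul_left _ _).mul_right _) (h₂ l)
  -- The lattice `L` is stable under `D` and contains 1, hence contains the image of `D`.
  have hmul : ∀ d : D, ∀ x ∈ L, j d * x ∈ L := by
    intro d
    have hd : d ∈ Algebra.adjoin ℤ (s : Set D) := hs ▸ trivial
    induction hd using Algebra.adjoin_induction with
    | mem y hy =>
      intro x hx
      induction hx using Submodule.span_induction with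
      | mem x hx =>
        obtain ⟨l, rfl⟩ := hx
        rw [← hc (j y * w l)]
        exact hL _ fun l' => hle ((dvd_mul_right _ _).mul_right _) (h₁ (⟨y, hy⟩, l, l'))
      | zero => simp
      | add x x' _ _ hx hx' => rw [mul_add]; exact add_mem hx hx'
      | smul a x _ hx => rw [mul_smul_comm]; exact Submodule.smul_mem _ _ hx
    | algebraMap z =>
      intro x hx
      have : j (algebraMap ℤ D z) * x = z • x := by simp
      rw [this]
      exact zsmul_mem hx z
    | add y z _ _ hy hz =>
      intro x hx
      rw [map_add, add_mul]
      exact add_mem (hy x hx) (hz x hx)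
    | mul y z _ _ hy hz =>
      intro x hx
      rw [map_mul, mul_assoc]
      exact hy _ (hz x hx)
  have hΦL : ∀ x ∈ L, ∀ t, Φ x t ∈ Pm := by
    intro x hx t
    induction hx using Submodule.span_induction with
    | mem x hx =>
      obtain ⟨l, rfl⟩ := hx
      exact hle (dvd_mul_left _ _) (h₃ (l, t))
    | zero => rw [map_zero]; exact zero_mem _
    | add x y _ _ hx hy => rw [map_add]; exact add_mem hx hy
    | smul a x _ hx =>
      have : a • x = (a : P) • x := rfl
      rw [this, map_smul]
      exact mul_mem a.2 hx
  have hjL : ∀ d, j d ∈ L := fun d => by simpa using hmul d 1 hone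
  refine of_finite_family (B := fun _ : Fin N => Pm) Finset.univ
    (fun _ _ => IsBoundedByCobounded.of_invPolynomials hm)
    (fun t => ((Pi.evalAddMonoidHom (fun _ : Fin N => P) t).comp
      (Φ.toAddMonoidHom.comp j.toAddMonoidHom)).codRestrict Pm.toAddSubgroup
        fun d => hΦL _ (hjL d) t) fun x hx => ?_
  apply hj
  rw [map_zero]
  apply hΦ
  rw [map_zero]
  ext1 t
  exact congrArg Subtype.val (hx t (Finset.mem_univ t))

theorem IsBoundedByCobounded.of_finiteType_domain (D : Type*) [CommRing D] [IsDomain D]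
    (hD : Algebra.FiniteType ℤ D) : IsBoundedByCobounded D := by
  by_cases h : ∃ n : ℕ, n ≠ 0 ∧ (n : D) = 0
  · obtain ⟨n, hn, h⟩ := h
    exact of_nsmul_eq_zero hn fun x => by rw [nsmul_eq_mul, h, zero_mul]
  · push Not at h
    have : CharZero D := charZero_of_inj_zero fun n hn => by
      by_contra h0
      exact h n h0 hn
    exact of_finiteType_domain_charZero D

/-- The additive group of a finitely generated module over a finitely generated commutative ring is
bounded-by-cobounded. -/
theorem IsBoundedByCobounded.of_module_finite (A : Type*) [CommRing A] [Algebra.FiniteType ℤ A]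
    (M : Type*) [AddCommGroup M] [Module A M] [hM : Module.Finite A M] :
    IsBoundedByCobounded M := by
  have : IsNoetherianRing A := Algebra.FiniteType.isNoetherianRing ℤ A
  induction hM using IsNoetherianRing.induction_on_isQuotientEquivQuotientPrime A with
  | subsingleton N => exact of_finite
  | quotient N p e =>
    have := p.2
    have h := Algebra.FiniteType.int_of_surjective (Ideal.Quotient.mk p.1)
      Ideal.Quotient.mk_surjective
    exact (of_finiteType_domain (A ⧸ p.1) h).of_injective e.toAddEquiv.toAddMonoidHom e.injective
  | exact N₁ N₂ N₃ f g hf hg hfg h₁ h₃ =>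
    refine of_ker g.toAddMonoidHom h₃ ?_
    let f' : N₁ ≃ₗ[A] LinearMap.range f := LinearEquiv.ofInjective f hf
    refine h₁.of_injective (f'.symm.toAddEquiv.toAddMonoidHom.comp
      (AddMonoidHom.codRestrict g.toAddMonoidHom.ker.subtype (LinearMap.range f).toAddSubgroup
        fun x => (hfg _).mp x.2)) (f'.symm.injective.comp fun x y h => ?_)
    exact Subtype.ext (congrArg (fun z : LinearMap.range f => (z : N₂)) h)

end AdditiveGroups

/-! ### Divisors, number fields and constants of function fields. -/

section FieldUnits

open IsDedekindDomain nonZeroDivisors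

theorem IsBoundedByCobounded.of_ker_finsupp_int {A ι : Type*} [AddCommGroup A] [Countable A]
    (f : A →+ (ι →₀ ℤ)) (h : IsBoundedByCobounded f.ker) : IsBoundedByCobounded A := by
  have : Countable f.range := f.rangeRestrict_surjective.countable
  have hr : IsBoundedByCobounded f.range := of_finsupp_int one_ne_zero f.range.subtype fun x hx => by
    rw [one_smul]; exact Subtype.ext hx
  refine of_ker f.rangeRestrict hr ?_
  rwa [AddMonoidHom.ker_rangeRestrict]

theorem IsBoundedByCobounded.of_le_range {A B : Type*} [AddCommGroup A] [AddCommGroup B]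
    (h : IsBoundedByCobounded B) (j : B →+ A) (hj : Function.Injective j) {S : AddSubgroup A}
    (hS : S ≤ j.range) : IsBoundedByCobounded S :=
  h.of_injective ((AddMonoidHom.ofInjective hj).symm.toAddMonoidHom.comp (AddSubgroup.inclusion hS))
    ((AddMonoidHom.ofInjective hj).symm.injective.comp (AddSubgroup.inclusion_injective hS))

/-- The divisor of a nonzero element of the fraction field of a Dedekind domain. -/
theorem exists_divisor_addMonoidHom (C L : Type*) [CommRing C] [IsDedekindDomain C] [Field L]
    [Algebra C L] [IsFractionRing C L] :
    ∃ f : Additive Lˣ →+ (HeightOneSpectrum C →₀ ℤ),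
      ∀ u : Lˣ, f (Additive.ofMul u) = 0 → ∃ c : C, algebraMap C L c = u := by
  let I : Lˣ → FractionalIdeal C⁰ L := fun u => FractionalIdeal.spanSingleton C⁰ (u : L)
  have hI : ∀ u, I u ≠ 0 := fun u => FractionalIdeal.spanSingleton_ne_zero_iff.mpr u.ne_zero
  let g : Lˣ → (HeightOneSpectrum C →₀ ℤ) := fun u =>
    Finsupp.ofSupportFinite (fun v => FractionalIdeal.count L v (I u))
      (FractionalIdeal.finite_factors (I u))
  have hg : ∀ u v, g u v = FractionalIdeal.count L v (I u) := fun u v => rfl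
  let f : Additive Lˣ →+ (HeightOneSpectrum C →₀ ℤ) := AddMonoidHom.mk' (fun u => g u.toMul) (by
    intro a b
    ext v
    rw [Finsupp.add_apply, hg, hg, hg, ← FractionalIdeal.count_mul L v (hI _) (hI _)]
    congr 1
    exact (FractionalIdeal.spanSingleton_mul_spanSingleton _ _).symm)
  refine ⟨f, fun u hu => ?_⟩
  have hc : ∀ v, FractionalIdeal.count L v (I u) = 0 := fun v => DFunLike.congr_fun hu v
  have h1 : I u = 1 := by
    rw [← FractionalIdeal.finprod_heightOneSpectrum_factorization' L (hI u)]
    simp [hc]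
  have h2 : (u : L) ∈ I u := FractionalIdeal.mem_spanSingleton_self C⁰ _
  rw [h1, FractionalIdeal.mem_one_iff] at h2
  exact h2

theorem exists_addMonoidHom_isIntegral (A K L : Type*) [CommRing A] [IsDedekindDomain A] [Field K]
    [Algebra A K] [IsFractionRing A K] [Field L] [Algebra K L] [Algebra A L] [IsScalarTower A K L]
    [FiniteDimensional K L] [Algebra.IsSeparable K L] :
    ∃ f : Additive Lˣ →+ (HeightOneSpectrum (integralClosure A L) →₀ ℤ),
      ∀ u : Lˣ, f (Additive.ofMul u) = 0 → IsIntegral A (u : L) := by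
  have := integralClosure.isDedekindDomain A K L
  have := integralClosure.isFractionRing_of_finite_extension (A := A) K L
  obtain ⟨f, hf⟩ := exists_divisor_addMonoidHom (integralClosure A L) L
  refine ⟨f, fun u hu => ?_⟩
  obtain ⟨c, hc⟩ := hf u hu
  exact hc ▸ c.2

section NumberField

open NumberField

/-- Dirichlet's unit theorem enters here, as the instance that the unit group is finite over ℤ. -/
theorem IsBoundedByCobounded.units_ringOfIntegers (K : Type*) [Field K] [NumberField K] :
    IsBoundedByCobounded (Additive (𝓞 K)ˣ) :=
  of_module_finite ℤ _

theorem IsBoundedByCobounded.units_numberField (K : Type*) [Field K] [NumberField K] [Countable K] :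
    IsBoundedByCobounded (Additive Kˣ) := by
  have : Countable Kˣ := Units.val_injective.countable
  have : Countable (Additive Kˣ) := ‹Countable Kˣ›
  obtain ⟨f, hf⟩ := exists_divisor_addMonoidHom (𝓞 K) K
  refine of_ker_finsupp_int f ?_
  -- Trivial divisor yields only integrality; applying this to the inverse as well gives a unit.
  have hu : ∀ x : f.ker, ∃ c : (𝓞 K)ˣ, algebraMap (𝓞 K) K c = (x : Additive Kˣ).toMul := by
    intro x
    obtain ⟨a, ha⟩ := hf _ x.2
    obtain ⟨b, hb⟩ := hf (x : Additive Kˣ).toMul⁻¹ (neg_mem x.2)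
    refine ⟨⟨a, b, ?_, ?_⟩, ha⟩ <;> apply IsFractionRing.injective (𝓞 K) K <;> rw [map_mul, map_one, ha, hb]
    · exact Units.mul_inv _
    · exact Units.inv_mul _
  have hi : Function.Injective (Units.map (algebraMap (𝓞 K) K : 𝓞 K →* K)) :=
    Units.map_injective (IsFractionRing.injective (𝓞 K) K)
  refine (units_ringOfIntegers K).of_le_range (MonoidHom.toAdditive (Units.map
    (algebraMap (𝓞 K) K : 𝓞 K →* K))) hi fun x hx => ?_
  obtain ⟨c, hc⟩ := hu ⟨x, hx⟩
  exact ⟨Additive.ofMul c, Units.ext hc⟩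

end NumberField

section FunctionField

variable {k K L : Type*} [Field k] [Field K] [Field L] [Algebra k K] [Algebra K L] [Algebra k L]
  [IsScalarTower k K L]

open Polynomial IntermediateField RatFunc

theorem isPrincipalIdealRing_adjoin_singleton (t : K) :
    IsPrincipalIdealRing (Algebra.adjoin k {t}) := by
  rw [Algebra.adjoin_singleton_eq_range_aeval]
  exact IsPrincipalIdealRing.of_surjective (aeval (R := k) t).rangeRestrict.toRingHom
    (aeval (R := k) t).rangeRestrict_surjective

theorem isFractionRing_adjoin_singleton {t : K} (ht : k⟮t⟯ = ⊤) :
    IsFractionRing (Algebra.adjoin k {t}) K :=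
  .of_field _ _ fun z => by
    obtain ⟨x, hx, y, hy, h⟩ := mem_adjoin_iff_div.mp (show z ∈ k⟮t⟯ from ht ▸ mem_top)
    exact ⟨⟨x, hx⟩, ⟨y, hy⟩, h⟩

theorem adjoin_inv_eq_top {t : K} (ht : k⟮t⟯ = ⊤) : k⟮t⁻¹⟯ = ⊤ := by
  rw [eq_top_iff, ← ht, adjoin_simple_le_iff]
  simpa using inv_mem (mem_adjoin_simple_self k t⁻¹)

/-- If p(t) = q(1/t), then multiplying by t^deg q gives p · X^deg q = reverse of q, whose degree is
at most deg q. So p is constant. -/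
theorem mem_range_algebraMap_of_mem_adjoin_of_mem_adjoin_inv {t : K} (ht : Transcendental k t)
    {c : K} (h : c ∈ Algebra.adjoin k {t}) (h' : c ∈ Algebra.adjoin k {t⁻¹}) :
    c ∈ (algebraMap k K).range := by
  rw [Algebra.adjoin_singleton_eq_range_aeval] at h h'
  obtain ⟨p, rfl⟩ := h
  obtain ⟨q, hq⟩ := h'
  change aeval t⁻¹ q = aeval t p at hq
  have ht0 : t ≠ 0 := fun h0 => ht (h0 ▸ isAlgebraic_zero)
  have h1 : aeval t q.reverse = aeval t (p * Polynomial.X ^ q.natDegree) := by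
    let : Invertible (t⁻¹) := invertibleOfNonzero (inv_ne_zero ht0)
    have := eval₂_reverse_mul_pow (algebraMap k K) (t⁻¹) q
    rw [invOf_eq_inv, inv_inv] at this
    rw [map_mul, map_pow, aeval_X, ← hq]
    change eval₂ _ _ _ = aeval t⁻¹ q * _
    change _ = aeval t⁻¹ q at this
    rw [← this, mul_assoc, ← mul_pow, inv_mul_cancel₀ ht0, one_pow, mul_one]
    rfl
  have h2 : q.reverse = p * Polynomial.X ^ q.natDegree := transcendental_iff_injective.mp ht h1
  have h3 : p.natDegree = 0 := by
    by_cases hp : p = 0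
    · simp [hp]
    have := q.reverse_natDegree_le
    rw [h2, natDegree_mul_X_pow _ hp] at this
    omega
  rw [eq_C_of_natDegree_eq_zero h3]
  exact ⟨p.coeff 0, by simp⟩

/-- Both k[t] and k[1/t] are integrally closed with fraction field `K`, so the minimal polynomial of
`z` over `K` has its coefficients in their intersection, which is `k`. -/
theorem isAlgebraic_of_isIntegral_adjoin {t : K} (ht : Transcendental k t) (htop : k⟮t⟯ = ⊤) {z : L}
    (h : IsIntegral (Algebra.adjoin k {t}) z) (h' : IsIntegral (Algebra.adjoin k {t⁻¹}) z) :
    IsAlgebraic k z := by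
  have := isPrincipalIdealRing_adjoin_singleton (k := k) t
  have := isPrincipalIdealRing_adjoin_singleton (k := k) t⁻¹
  have := isFractionRing_adjoin_singleton htop
  have := isFractionRing_adjoin_singleton (adjoin_inv_eq_top htop)
  have h1 := minpoly.isIntegrallyClosed_eq_field_fractions' K h
  have h2 := minpoly.isIntegrallyClosed_eq_field_fractions' K h'
  have hcoef : minpoly K z ∈ lifts (algebraMap k K) := by
    rw [lifts_iff_coeff_lifts]
    intro n
    refine mem_range_algebraMap_of_mem_adjoin_of_mem_adjoin_inv ht ?_ ?_
    · rw [h1, coeff_map]; exact Subtype.property _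
    · rw [h2, coeff_map]; exact Subtype.property _
  obtain ⟨p, hp⟩ := hcoef
  have hz : IsIntegral K z := h.tower_top
  refine ⟨p, ?_, ?_⟩
  · rintro rfl
    exact minpoly.ne_zero hz (by rw [← hp]; simp)
  · have := minpoly.aeval K z
    rw [← hp] at this
    simpa [aeval_map_algebraMap] using this

/-- `t` stays transcendental over the field of constants E, so [E : k] = [E(t) : k(t)] ≤ [L : K]. -/
theorem finiteDimensional_algebraicClosure {t : K} (ht : Transcendental k t) (htop : k⟮t⟯ = ⊤)
    [FiniteDimensional K L] : FiniteDimensional k (algebraicClosure k L) := by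
  let E := algebraicClosure k L
  let s : L := algebraMap K L t
  have hs : Transcendental k s := (transcendental_algebraMap_iff (algebraMap K L).injective).mpr ht
  have hsE : Transcendental E s := hs.algebraicClosure
  let : Algebra k[X] K := (aeval t).toAlgebra
  let : Algebra k[X] L := (aeval s).toAlgebra
  let : Algebra E[X] L := (aeval s).toAlgebra
  have : FaithfulSMul k[X] L :=
    (faithfulSMul_iff_algebraMap_injective _ _).mpr (transcendental_iff_injective.mp hs)
  have : FaithfulSMul k[X] K :=
    (faithfulSMul_iff_algebraMap_injective _ _).mpr (transcendental_iff_injective.mp ht)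
  have : FaithfulSMul E[X] L :=
    (faithfulSMul_iff_algebraMap_injective _ _).mpr (transcendental_iff_injective.mp hsE)
  have : IsScalarTower k[X] K L := IsScalarTower.of_algebraMap_eq fun p =>
    aeval_algebraMap_apply L t p
  have : IsFractionRing k[X] K := .of_field _ _ fun z => by
    obtain ⟨p, q, h⟩ := (mem_adjoin_simple_iff k z).mp (show z ∈ k⟮t⟯ from htop ▸ mem_top)
    exact ⟨p, q, h⟩
  have : FunctionField k L := (functionField_iff k L K).mpr inferInstance
  let : Algebra k[X] E[X] := Polynomial.algebra k E
  have : IsScalarTower k[X] E[X] L := IsScalarTower.of_algebraMap_eq fun p => by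
    change aeval s p = aeval s (p.map (algebraMap k E))
    rw [aeval_map_algebraMap]
  exact FunctionField.finiteDimensional_of_constantExtension (F := k) (E := E) L

end FunctionField

end FieldUnits

/-! ### Units of finitely generated fields and domains. -/

section FinitelyGeneratedFields

open IsDedekindDomain nonZeroDivisors IntermediateField

section FunctionFieldUnits

variable {k K L : Type*} [Field k] [Field K] [Field L] [Algebra k K] [Algebra K L] [Algebra k L]
  [IsScalarTower k K L]

/-- The integral closures of k[t] and k[1/t] together see all places of `L`, including those at
infinity. A unit with trivial divisor on both is therefore a constant. -/
theorem IsBoundedByCobounded.units_of_isSeparable {t : K} (ht : Transcendental k t)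
    (htop : k⟮t⟯ = ⊤) [FiniteDimensional K L] [Algebra.IsSeparable K L] [Countable L]
    (h : IsBoundedByCobounded (Additive (algebraicClosure k L)ˣ)) :
    IsBoundedByCobounded (Additive Lˣ) := by
  have : Countable Lˣ := Units.val_injective.countable
  have : Countable (Additive Lˣ) := ‹Countable Lˣ›
  have := isPrincipalIdealRing_adjoin_singleton (k := k) t
  have := isPrincipalIdealRing_adjoin_singleton (k := k) t⁻¹
  have := isFractionRing_adjoin_singleton htop
  have := isFractionRing_adjoin_singleton (adjoin_inv_eq_top htop)
  obtain ⟨f, hf⟩ := exists_addMonoidHom_isIntegral (Algebra.adjoin k {t}) K L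
  obtain ⟨g, hg⟩ := exists_addMonoidHom_isIntegral (Algebra.adjoin k {t⁻¹}) K L
  refine of_ker_finsupp_int f (of_ker_finsupp_int (g.comp f.ker.subtype) ?_)
  let j : (algebraicClosure k L)ˣ →* Lˣ := Units.map (algebraMap (algebraicClosure k L) L)
  have hj : Function.Injective j := Units.map_injective Subtype.val_injective
  have hS : f.ker ⊓ g.ker ≤ (MonoidHom.toAdditive j).range := by
    rintro u ⟨huf, hug⟩
    have halg : ∀ v : Lˣ, f (.ofMul v) = 0 → g (.ofMul v) = 0 → (v : L) ∈ algebraicClosure k L :=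
      fun v h₁ h₂ => mem_algebraicClosure_iff.mpr
        (isAlgebraic_of_isIntegral_adjoin ht htop (hf v h₁) (hg v h₂))
    refine ⟨Additive.ofMul ⟨⟨_, halg u.toMul huf hug⟩,
      ⟨_, halg u.toMul⁻¹ (f.ker.neg_mem huf) (g.ker.neg_mem hug)⟩, ?_, ?_⟩, Units.ext rfl⟩
    · exact Subtype.ext (Units.mul_inv _)
    · exact Subtype.ext (Units.inv_mul _)
  refine (h.of_le_range (MonoidHom.toAdditive j) hj hS).of_injective
    ((f.ker.subtype.comp (g.comp f.ker.subtype).ker.subtype).codRestrict _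
      fun x => ⟨x.1.2, x.2⟩) fun x y hxy => ?_
  exact Subtype.ext (Subtype.ext (congrArg (fun z : (f.ker ⊓ g.ker : AddSubgroup _) =>
    (z : Additive Lˣ)) hxy))

end FunctionFieldUnits

theorem IsBoundedByCobounded.units_of_injective {K L : Type*} [Field K] [Field L]
    (h : IsBoundedByCobounded (Additive Lˣ)) (f : K →+* L) : IsBoundedByCobounded (Additive Kˣ) :=
  h.of_injective (MonoidHom.toAdditive (Units.map (f : K →* L))) (Units.map_injective f.injective)

/-- The units of every finite extension of `k` form a bounded-by-cobounded group. -/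
def FiniteExtensionUnits (k : Type u) [Field k] : Prop :=
  ∀ (L : Type u) [Field L] [Algebra k L] [FiniteDimensional k L],
    IsBoundedByCobounded (Additive Lˣ)

namespace FiniteExtensionUnits

/-- An iterated Frobenius embeds `L` in the separable closure of `K` in `L`, reducing to the
separable case. The constants there may be larger than `k`, which is why the inductive property
speaks of all finite extensions. -/
theorem of_transcendental {k K : Type u} [Field k] [Field K] [Algebra k K] [Countable K]
    (hk : FiniteExtensionUnits k) {t : K} (ht : Transcendental k t) (htop : k⟮t⟯ = ⊤) :
    FiniteExtensionUnits K := by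
  intro L _ _ _
  let S := separableClosure K L
  let p := ringExpChar K
  let φ : L →+* S := IsPurelyInseparable.iterateFrobenius S L p le_rfl
  let : Algebra k S := ((algebraMap K S).comp (algebraMap k K)).toAlgebra
  have : IsScalarTower k K S := IsScalarTower.of_algebraMap_eq fun _ => rfl
  have : FiniteDimensional k (algebraicClosure k S) := finiteDimensional_algebraicClosure ht htop
  have : Countable S := (Module.finBasis K S).equivFun.toEquiv.injective.countable
  exact (IsBoundedByCobounded.units_of_isSeparable ht htop
    (hk (algebraicClosure k S))).units_of_injective φ

theorem of_finiteDimensional {k K : Type u} [Field k] [Field K] [Algebra k K]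
    [FiniteDimensional k K] (hk : FiniteExtensionUnits k) : FiniteExtensionUnits K := by
  intro L _ _ _
  let : Algebra k L := ((algebraMap K L).comp (algebraMap k K)).toAlgebra
  have : IsScalarTower k K L := IsScalarTower.of_algebraMap_eq fun _ => rfl
  have : FiniteDimensional k L := FiniteDimensional.trans k K L
  exact hk L

theorem adjoin_simple {k E : Type u} [Field k] [Field E] [Algebra k E] [Countable E]
    (hk : FiniteExtensionUnits k) (x : E) : FiniteExtensionUnits k⟮x⟯ := by
  by_cases hx : IsAlgebraic k x
  · have := adjoin.finiteDimensional hx.isIntegral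
    exact hk.of_finiteDimensional
  · refine hk.of_transcendental (t := AdjoinSimple.gen k x) (fun h => hx ?_) ?_
    · simpa using h.algebraMap (A := E)
    · apply map_injective k⟮x⟯.val
      rw [adjoin_map, Set.image_singleton, ← AlgHom.fieldRange_eq_map, fieldRange_val]
      rfl

theorem of_numberField {k : Type u} [Field k] [NumberField k] : FiniteExtensionUnits k := by
  intro L _ _ _
  have : CharZero L := charZero_of_injective_algebraMap (algebraMap k L).injective
  have : FiniteDimensional ℚ L := FiniteDimensional.trans ℚ k L
  have : NumberField L := ⟨⟩
  have : Countable L := (Module.finBasis ℚ L).equivFun.toEquiv.injective.countable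
  exact IsBoundedByCobounded.units_numberField L

theorem of_finite {k : Type u} [Field k] [Finite k] : FiniteExtensionUnits k := by
  intro L _ _ _
  have : Finite L := Module.finite_of_finite k
  have : Finite (Additive Lˣ) := inferInstanceAs (Finite Lˣ)
  exact IsBoundedByCobounded.of_finite

end FiniteExtensionUnits

theorem IsBoundedByCobounded.units_of_fg {F : Type*} {K : Type u} [Field F] [Field K] [Algebra F K]
    [Countable K] (hF : FiniteExtensionUnits (⊥ : IntermediateField F K))
    (h : (⊤ : IntermediateField F K).FG) : IsBoundedByCobounded (Additive Kˣ) := by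
  have : FiniteExtensionUnits (⊤ : IntermediateField F K) :=
    induction_on_adjoin_fg (fun E : IntermediateField F K => FiniteExtensionUnits E) hF
      (fun E x hE => hE.adjoin_simple x) ⊤ h
  have : FiniteDimensional (⊤ : IntermediateField F K) K :=
    Module.Finite.of_surjective (Algebra.linearMap _ K) fun x => ⟨⟨x, mem_top⟩, rfl⟩
  exact ‹FiniteExtensionUnits (⊤ : IntermediateField F K)› K

theorem Algebra.FiniteType.countable_of_int (D : Type*) [CommRing D] [hD : Algebra.FiniteType ℤ D] :
    Countable D := by
  obtain ⟨n, f, hf⟩ := Algebra.FiniteType.iff_quotient_mvPolynomial''.mp hD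
  have : Countable (MvPolynomial (Fin n) ℤ) :=
    (AddMonoidAlgebra.coeffAddEquiv (R := ℤ) (M := Fin n →₀ ℕ)).injective.countable
  exact hf.countable

theorem IsBoundedByCobounded.units_of_essFiniteType (K : Type u) [Field K] [Countable K]
    {φ : ℤ →+* K} (hφ : φ.EssFiniteType) : IsBoundedByCobounded (Additive Kˣ) := by
  have : Algebra.EssFiniteType ℤ K :=
    RingHom.essFiniteType_algebraMap.mp (by rwa [RingHom.ext_int (algebraMap ℤ K) φ])
  obtain ⟨p, hp⟩ := CharP.exists K
  rcases CharP.char_is_prime_or_zero K p with hp' | rfl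
  · have := Fact.mk hp'
    let := ZMod.algebra K p
    have : Algebra.EssFiniteType (ZMod p) K := .of_comp ℤ (ZMod p) K
    refine units_of_fg ?_ (fg_top (ZMod p) K)
    have : Finite (⊥ : IntermediateField (ZMod p) K) := Module.finite_of_finite (ZMod p)
    exact .of_finite
  · have : CharZero K := CharP.charP_to_charZero K
    have : Algebra.EssFiniteType ℚ K := .of_comp ℤ ℚ K
    refine units_of_fg ?_ (fg_top ℚ K)
    have : FiniteDimensional ℚ (⊥ : IntermediateField ℚ K) := inferInstance
    have : NumberField (⊥ : IntermediateField ℚ K) := ⟨⟩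
    exact .of_numberField

/-- The unit group of a finitely generated domain is bounded-by-cobounded. -/
theorem IsBoundedByCobounded.units_of_domain (D : Type u) [CommRing D] [IsDomain D]
    [hD : Algebra.FiniteType ℤ D] : IsBoundedByCobounded (Additive Dˣ) := by
  have : Countable D := Algebra.FiniteType.countable_of_int D
  have : Countable (FractionRing D) :=
    (IsLocalization.mk'_surjective D⁰ (S := FractionRing D)).countable
  have h : (algebraMap D (FractionRing D)).EssFiniteType :=
    RingHom.essFiniteType_algebraMap.mpr (.of_isLocalization _ D⁰)
  have hK := units_of_essFiniteType (FractionRing D)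
    ((RingHom.FiniteType.essFiniteType (RingHom.finiteType_algebraMap.mpr hD)).comp h)
  exact hK.of_injective
    (MonoidHom.toAdditive (Units.map (algebraMap D (FractionRing D) : D →* FractionRing D)))
    (Units.map_injective (IsFractionRing.injective D _))

end FinitelyGeneratedFields

/-! ### Units of finitely generated rings, and the conclusion. -/

theorem RingHom.FiniteType.algebra_int {A : Type*} [CommRing A] {φ : ℤ →+* A}
    (hφ : φ.FiniteType) : Algebra.FiniteType ℤ A :=
  RingHom.finiteType_algebraMap.mp (by rwa [RingHom.ext_int (algebraMap ℤ A) φ])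

namespace IsBoundedByCobounded

/-- On the kernel, uv − 1 = (u − 1) + (v − 1) + (u − 1)(v − 1) and the last product vanishes, so u ↦
u − 1 embeds it in the additive group of `A`. -/
theorem units_of_ker_mul_eq_zero {A B : Type*} [CommRing A] [CommRing B] [Algebra.FiniteType ℤ A]
    (f : A →+* B) (hf : ∀ x y, f x = 0 → f y = 0 → x * y = 0)
    (h : IsBoundedByCobounded (Additive Bˣ)) : IsBoundedByCobounded (Additive Aˣ) := by
  let F : Additive Aˣ →+ Additive Bˣ := MonoidHom.toAdditive (Units.map (f : A →* B))
  have hF : ∀ u : F.ker, f ((u : Additive Aˣ).toMul - 1 : A) = 0 := fun u => by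
    have : f ((u : Additive Aˣ).toMul : A) = 1 :=
      congrArg (fun x : Additive Bˣ => (x.toMul : B)) u.2
    rw [map_sub, map_one, this, sub_self]
  let g : F.ker →+ A := AddMonoidHom.mk' (fun u => ((u : Additive Aˣ).toMul : A) - 1) fun u v => by
    have := hf _ _ (hF u) (hF v)
    rw [AddSubgroup.coe_add, toMul_add, Units.val_mul]
    linear_combination this
  refine of_ker F h ((of_module_finite A A).of_injective g fun u v huv => ?_)
  exact Subtype.ext (Units.ext (sub_left_injective huv))

theorem units_of_isNilpotent {A : Type u} [CommRing A] [Algebra.FiniteType ℤ A] (I : Ideal A)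
    (hI : IsNilpotent I) (h : IsBoundedByCobounded (Additive (A ⧸ I)ˣ)) :
    IsBoundedByCobounded (Additive Aˣ) := by
  refine Ideal.IsNilpotent.induction_on (S := A) (P := fun S _ I => Algebra.FiniteType ℤ S →
    IsBoundedByCobounded (Additive (S ⧸ I)ˣ) → IsBoundedByCobounded (Additive Sˣ)) I hI
    (fun S _ I hI hS h => ?_) (fun S _ I J hIJ h₁ h₂ hS h => ?_) ‹_› h
  · refine units_of_ker_mul_eq_zero (Ideal.Quotient.mk I) (fun x y hx hy => ?_) h
    rw [Ideal.Quotient.eq_zero_iff_mem] at hx hy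
    have := Ideal.mul_mem_mul hx hy
    rwa [← sq, hI] at this
  · refine h₁ hS (h₂ (Algebra.FiniteType.int_of_surjective (Ideal.Quotient.mk I)
      Ideal.Quotient.mk_surjective) ?_)
    let e := DoubleQuot.quotQuotEquivQuotOfLE hIJ
    exact h.of_injective (MonoidHom.toAdditive (Units.map (e.toRingHom : _ →* S ⧸ J)))
      (Units.map_injective e.injective)

/-- The unit group of a finitely generated commutative ring is bounded-by-cobounded. -/
theorem units (A : Type u) [CommRing A] [Algebra.FiniteType ℤ A] :
    IsBoundedByCobounded (Additive Aˣ) := by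
  have : IsNoetherianRing A := Algebra.FiniteType.isNoetherianRing ℤ A
  refine units_of_isNilpotent (nilradical A) (IsNoetherianRing.isNilpotent_nilradical A) ?_
  have hfin := minimalPrimes.finite_of_isNoetherianRing A
  have hle : ∀ p : minimalPrimes A, nilradical A ≤ p.1 := fun p =>
    nilradical_le_prime (H := p.2.1.1) p.1
  -- The nilradical is the intersection of the finitely many minimal primes, so the reduced ring
  -- embeds in the product of the domains A/p.
  refine of_finite_family (B := fun p : minimalPrimes A => Additive (A ⧸ p.1)ˣ)
    (Set.finite_univ_iff.mpr hfin).toFinset (fun p _ => ?_)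
    (fun p => MonoidHom.toAdditive (Units.map
      (Ideal.Quotient.factor (hle p) : A ⧸ nilradical A →* A ⧸ p.1))) fun x hx => ?_
  · have : p.1.IsPrime := p.2.1.1
    have := Algebra.FiniteType.int_of_surjective (Ideal.Quotient.mk p.1)
      Ideal.Quotient.mk_surjective
    exact units_of_domain (A ⧸ p.1)
  · refine Units.ext ?_
    obtain ⟨a, ha⟩ := Ideal.Quotient.mk_surjective (x.toMul : A ⧸ nilradical A)
    change (x.toMul : A ⧸ nilradical A) = 1
    rw [← ha, ← map_one (Ideal.Quotient.mk (nilradical A)), Ideal.Quotient.eq, nilradical,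
      ← Ideal.sInf_minimalPrimes, Submodule.mem_sInf]
    intro p hp
    have h : Ideal.Quotient.factor (hle ⟨p, hp⟩) (x.toMul : A ⧸ nilradical A) = 1 :=
      congrArg (fun u : Additive (A ⧸ p)ˣ => (u.toMul : A ⧸ p)) (hx ⟨p, hp⟩ (by simp))
    rwa [← ha, Ideal.Quotient.factor_mk, ← map_one (Ideal.Quotient.mk p), Ideal.Quotient.eq] at h

end IsBoundedByCobounded

theorem IsArithmeticallyLinear.exists_injective_units {H : Type u} [AddCommGroup H]
    (h : IsArithmeticallyLinear.{u, v} (Multiplicative H)) :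
    ∃ (A : Type v) (_ : CommRing A) (_ : Algebra.FiniteType ℤ A) (f : H →+ Additive Aˣ),
      Function.Injective f := by
  obtain ⟨n, C, _, hC, f, hf⟩ := h
  have : IsNoetherianRing C := Algebra.FiniteType.isNoetherianRing ℤ C
  let M := Matrix (Fin n) (Fin n) C
  let s : Set M := Set.range fun x => (f x : M)
  let A := Algebra.adjoin C s
  have : IsMulCommutative A := Algebra.isMulCommutative_adjoin C (by
    rintro _ ⟨x, rfl⟩ _ ⟨y, rfl⟩
    change (f x : M) * (f y : M) = (f y : M) * (f x : M)
    rw [← Units.val_mul, ← Units.val_mul, ← map_mul, ← map_mul, mul_comm])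
  let : CommRing A := { (inferInstance : Ring A) with mul_comm := mul_comm' }
  have hmem : ∀ x, (f x : M) ∈ A := fun x => Algebra.subset_adjoin ⟨x, rfl⟩
  -- `A` is a submodule of the Noetherian `C`-module of matrices. Finiteness over `C` makes it a
  -- finitely generated ring even if `H` is not finitely generated.
  have hfin : RingHom.Finite (B := A) (algebraMap C A) := by
    have : IsNoetherian C M := inferInstance
    have : Module.Finite C A := inferInstanceAs (Module.Finite C (Subalgebra.toSubmodule A))
    exact RingHom.finite_algebraMap.mpr this
  have hA : RingHom.FiniteType (B := A) ((algebraMap C A).comp (algebraMap ℤ C)) :=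
    (RingHom.Finite.finiteType hfin).comp (RingHom.finiteType_algebraMap.mpr hC)
  let g : Multiplicative H →* A :=
    { toFun := fun x => ⟨f x, hmem x⟩
      map_one' := Subtype.ext (by simp)
      map_mul' := fun x y => Subtype.ext (by simp) }
  refine ⟨A, inferInstance, hA.algebra_int, MonoidHom.toAdditiveRight g.toHomUnits,
    fun x y hxy => ?_⟩
  have : g (.ofAdd x) = g (.ofAdd y) := congrArg (fun u : Additive Aˣ => (u.toMul : A)) hxy
  exact Multiplicative.ofAdd.injective (hf (Units.ext (congrArg Subtype.val this)))

theorem mainTheorem8 (H : Type u) [AddCommGroup H] :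
    IsArithmeticallyLinear.{u, v} (Multiplicative H) ↔
      Countable H ∧ IsBoundedTimesCobounded H := by
  refine ⟨fun h => ?_, fun ⟨_, h⟩ => h.isArithmeticallyLinear⟩
  obtain ⟨A, _, _, f, hf⟩ := h.exists_injective_units
  have : Countable A := Algebra.FiniteType.countable_of_int A
  have : Countable Aˣ := Units.val_injective.countable
  have : Countable H := (Additive.toMul.injective.comp hf).countable
  exact ⟨this, ((IsBoundedByCobounded.units A).of_injective f hf).isBoundedTimesCobounded⟩
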